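/- Let $H^1(\mathbb{R})=W^{1,2}(\mathbb{R})$ be the real-valued Sobolev space on $\mathbb{R}$, and let $V\in L^\infty(\mathbb{R})$ be a real-valued function such that $0<v_0\le V(x)\le v_1$ for almost every $x\in\mathbb{R}$, where $v_0,v_1$ are constants. For $u\in H^1(\mathbb{R})$, with weak derivative $u'$, put $$\|u\|_V^2:=\int_{-\infty}^{\infty}\bigl(|u'(x)|^2+V(x)|u(x)|^2\bigr)\,dx,\qquad \|u\|_\infty:=\|u\|_{L^\infty(\mathbb{R})},$$ and define $$m(V):=\inf_{u\in H^1(\mathbb{R}),\ u\not\equiv 0}\ \frac{\|u\|_V^2}{\|u\|_\infty^2}.$$ Then $$\frac{2v_0}{\sqrt{v_1}}\le m(V)\le \frac{2v_1}{\sqrt{v_0}}.$$ -/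

import Mathlib

open MeasureTheory

namespace SobolevOneDim

/-- `g` is a weak (distributional) derivative of `u` on the real line:
`∫ u φ' = - ∫ g φ` for every smooth compactly supported `φ`. -/
def HasWeakDeriv (u g : ℝ → ℝ) : Prop :=
  LocallyIntegrable u volume ∧ LocallyIntegrable g volume ∧
    ∀ φ : ℝ → ℝ, ContDiff ℝ ((⊤ : ℕ∞) : WithTop ℕ∞) φ → HasCompactSupport φ →
      ∫ x, u x * deriv φ x = - ∫ x, g x * φ x

/-- `u` (as an almost-everywhere class) belongs to the real Sobolev space `H¹(ℝ) = W^{1,2}(ℝ)`. -/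
def MemH1 (u : ℝ → ℝ) : Prop :=
  MemLp u 2 volume ∧ ∃ g : ℝ → ℝ, MemLp g 2 volume ∧ HasWeakDeriv u g

open Classical in
/-- The weak derivative of `u` (unique up to null sets); the zero function if there is none. -/
noncomputable def weakDeriv (u : ℝ → ℝ) : ℝ → ℝ :=
  if h : ∃ g : ℝ → ℝ, HasWeakDeriv u g then h.choose else 0

/-- Weak derivatives are unique up to null sets, so `weakDeriv` is well defined. -/
theorem HasWeakDeriv.ae_eq {u g h : ℝ → ℝ} (hg : HasWeakDeriv u g) (hh : HasWeakDeriv u h) :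
    g =ᵐ[volume] h := by
  refine ae_eq_of_integral_contDiff_smul_eq hg.2.1 hh.2.1 fun φ hφ hc => ?_
  have h1 := hg.2.2 φ hφ hc
  have h2 := hh.2.2 φ hφ hc
  simp only [smul_eq_mul, mul_comm (φ _)]
  linarith

theorem HasWeakDeriv.weakDeriv_ae_eq {u g : ℝ → ℝ} (hg : HasWeakDeriv u g) :
    weakDeriv u =ᵐ[volume] g := by
  have h : ∃ g : ℝ → ℝ, HasWeakDeriv u g := ⟨g, hg⟩
  have e : weakDeriv u = h.choose := dif_pos h
  rw [e]
  exact h.choose_spec.ae_eq hg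

/-- `‖u‖_V² = ∫ (|u'|² + V |u|²) dx`. -/
noncomputable def normVSq (V u : ℝ → ℝ) : ℝ :=
  ∫ x, (|weakDeriv u x| ^ 2 + V x * |u x| ^ 2)

/-- The norm `‖u‖_∞` of `L^∞(ℝ)`, that is, the essential supremum of `|u|`. -/
noncomputable def supNorm (u : ℝ → ℝ) : ℝ :=
  (eLpNorm u ⊤ volume).toReal

/-- The Rayleigh-type quotient `R(u; V) = ‖u‖_V² / ‖u‖_∞²`. -/
noncomputable def rayleigh (V u : ℝ → ℝ) : ℝ :=
  normVSq V u / supNorm u ^ 2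

/-- `m(V)`, the infimum of `R(u; V)` over the nonzero elements `u` of `H¹(ℝ)`. -/
noncomputable def m (V : ℝ → ℝ) : ℝ :=
  sInf {r : ℝ | ∃ u : ℝ → ℝ, MemH1 u ∧ ¬ u =ᵐ[volume] 0 ∧ r = rayleigh V u}

end SobolevOneDim

namespace SobolevOneDim

open scoped Convolution

open ContinuousLinearMap Filter Topology Set

/-! In fact `2 * √v₀ ≤ m V ≤ 2 * √v₁`; the stated bounds are weaker because `v₀ ≤ v₁`. Lower bound:
for differentiable `f`, integrate `(f ^ 2)'` over both half-lines ending at `x` and use `2 * a * |f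
* f'| ≤ f' ^ 2 + a ^ 2 * f ^ 2` (`two_mul_sq_le_of_hasDerivAt`). Mollification, which does not
increase L² norms and converges almost everywhere, carries this over to H¹
(`HasWeakDeriv.ae_two_mul_sq_le`); take `a = √v₀`. Upper bound: test with `exp (-(√v₁ * |x|))`, the
extremal of the constant potential `v₁` (`rayleigh_exp_abs_le`). -/

/-! ### Mollification in L² -/

/-- Jensen's inequality for the convolution with a probability density. -/
theorem sq_convolution_le {f u : ℝ → ℝ} (hf : Continuous f) (hfc : HasCompactSupport f)
    (hf0 : ∀ x, 0 ≤ f x) (hf1 : ∫ x, f x = 1) (hu : LocallyIntegrable u volume)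
    (hu2 : LocallyIntegrable (fun x => u x ^ 2) volume) (x : ℝ) :
    (f ⋆[lsmul ℝ ℝ, volume] u) x ^ 2 ≤ (f ⋆[lsmul ℝ ℝ, volume] fun y => u y ^ 2) x := by
  have i1 : Integrable (fun t => f t * u (x - t)) volume :=
    hfc.convolutionExists_left (lsmul ℝ ℝ) hf hu x
  have i2 : Integrable (fun t => f t * u (x - t) ^ 2) volume :=
    hfc.convolutionExists_left (lsmul ℝ ℝ) hf hu2 x
  have i0 : Integrable f volume := hf.integrable_of_hasCompactSupport hfc
  set c := (f ⋆[lsmul ℝ ℝ, volume] u) x with hc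
  have hc' : ∫ t, f t * u (x - t) = c := rfl
  -- Nonnegativity of the variance of `u (x - ·)` under the density `f`, whose mean is `c`.
  have h : 0 ≤ ∫ t, f t * (u (x - t) - c) ^ 2 :=
    integral_nonneg fun t => mul_nonneg (hf0 t) (sq_nonneg _)
  have e : ∀ t, f t * (u (x - t) - c) ^ 2
      = f t * u (x - t) ^ 2 - 2 * c * (f t * u (x - t)) + c ^ 2 * f t := fun t => by ring
  simp_rw [e] at h
  rw [integral_add (f := fun t => f t * u (x - t) ^ 2 - 2 * c * (f t * u (x - t)))
      (i2.sub (i1.const_mul _)) (i0.const_mul _), integral_sub i2 (i1.const_mul _), integral_const_mul, integral_const_mul, hf1, hc'] at h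
  have e2 : (f ⋆[lsmul ℝ ℝ, volume] fun y => u y ^ 2) x = ∫ t, f t * u (x - t) ^ 2 := rfl
  rw [e2]
  linarith

theorem integrable_sq_convolution {f u : ℝ → ℝ} (hf : Continuous f) (hfc : HasCompactSupport f)
    (hf0 : ∀ x, 0 ≤ f x) (hf1 : ∫ x, f x = 1) (hu : LocallyIntegrable u volume)
    (hu2 : Integrable (fun x => u x ^ 2) volume) :
    Integrable (fun x => (f ⋆[lsmul ℝ ℝ, volume] u) x ^ 2) volume := by
  have i0 : Integrable f volume := hf.integrable_of_hasCompactSupport hfc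
  refine (i0.integrable_convolution (lsmul ℝ ℝ) hu2).mono'
    ((hfc.continuous_convolution_left (lsmul ℝ ℝ) hf hu).pow 2).aestronglyMeasurable
    (ae_of_all _ fun x => ?_)
  rw [Real.norm_of_nonneg (sq_nonneg _)]
  exact sq_convolution_le hf hfc hf0 hf1 hu hu2.locallyIntegrable x

/-- Young's inequality in `L²` for the convolution with a probability density. -/
theorem integral_sq_convolution_le {f u : ℝ → ℝ} (hf : Continuous f) (hfc : HasCompactSupport f)
    (hf0 : ∀ x, 0 ≤ f x) (hf1 : ∫ x, f x = 1) (hu : LocallyIntegrable u volume)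
    (hu2 : Integrable (fun x => u x ^ 2) volume) :
    ∫ x, (f ⋆[lsmul ℝ ℝ, volume] u) x ^ 2 ≤ ∫ x, u x ^ 2 := by
  have i0 : Integrable f volume := hf.integrable_of_hasCompactSupport hfc
  calc ∫ x, (f ⋆[lsmul ℝ ℝ, volume] u) x ^ 2
      ≤ ∫ x, (f ⋆[lsmul ℝ ℝ, volume] fun y => u y ^ 2) x :=
        integral_mono (integrable_sq_convolution hf hfc hf0 hf1 hu hu2)
          (i0.integrable_convolution (lsmul ℝ ℝ) hu2)
          fun x => sq_convolution_le hf hfc hf0 hf1 hu hu2.locallyIntegrable x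
    _ = ∫ x, u x ^ 2 := by
        rw [integral_convolution (lsmul ℝ ℝ) i0 hu2, hf1]
        simp

/-- Mollification commutes with the weak derivative. -/
theorem HasWeakDeriv.hasDerivAt_convolution {f u g : ℝ → ℝ} (h : HasWeakDeriv u g)
    (hf : ContDiff ℝ ((⊤ : ℕ∞) : WithTop ℕ∞) f) (hfc : HasCompactSupport f) (x : ℝ) :
    HasDerivAt (f ⋆[lsmul ℝ ℝ, volume] u) ((f ⋆[lsmul ℝ ℝ, volume] g) x) x := by
  have hd := hfc.hasDerivAt_convolution_left (lsmul ℝ ℝ) (hf.of_le (by exact_mod_cast le_top))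
    h.1 x
  suffices e : (f ⋆[lsmul ℝ ℝ, volume] g) x = (deriv f ⋆[lsmul ℝ ℝ, volume] u) x by
    rw [e]
    exact hd
  rw [convolution_eq_swap, convolution_eq_swap]
  have hψ : ContDiff ℝ ((⊤ : ℕ∞) : WithTop ℕ∞) fun t => f (x - t) :=
    hf.comp (contDiff_const.sub contDiff_id)
  have hψc : HasCompactSupport fun t => f (x - t) :=
    hfc.comp_homeomorph (Homeomorph.subLeft x)
  have key := h.2.2 _ hψ hψc
  have e : ∀ t, deriv (fun t => f (x - t)) t = - deriv f (x - t) := fun t =>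
    deriv_comp_const_sub f x t
  simp only [e, mul_neg, integral_neg, neg_inj] at key
  simp only [lsmul_apply, smul_eq_mul]
  simp only [mul_comm (f _), mul_comm (deriv f _)]
  exact key.symm

/-! ### The sharp embedding of H¹ into L^∞ -/

/-- The sharp pointwise bound for functions in `H¹(ℝ)` that are differentiable everywhere. -/
theorem two_mul_sq_le_of_hasDerivAt {f f' : ℝ → ℝ} {a : ℝ} (ha : 0 < a)
    (hd : ∀ x, HasDerivAt f (f' x) x) (hm : AEStronglyMeasurable f' volume)
    (hf : Integrable (fun x => f x ^ 2) volume)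
    (hf' : Integrable (fun x => f' x ^ 2) volume) (x : ℝ) :
    2 * a * f x ^ 2 ≤ (∫ y, f' y ^ 2) + a ^ 2 * ∫ y, f y ^ 2 := by
  have hfcont : Continuous f := continuous_iff_continuousAt.2 fun x => (hd x).continuousAt
  have hd2 : ∀ y, HasDerivAt (fun y => f y ^ 2) (2 * f y * f' y) y := fun y => by
    simpa using (hd y).fun_pow 2
  have iR : Integrable (fun y => f' y ^ 2 + a ^ 2 * f y ^ 2) volume := hf'.add (hf.const_mul _)
  have bd : ∀ y, |a * (2 * f y * f' y)| ≤ f' y ^ 2 + a ^ 2 * f y ^ 2 := fun y => by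
    rw [abs_le]
    constructor <;> nlinarith [sq_nonneg (f' y - a * f y), sq_nonneg (f' y + a * f y)]
  have iD' : Integrable (fun y => a * (2 * f y * f' y)) volume :=
    iR.mono' (((hfcont.aestronglyMeasurable.const_mul 2).mul hm).const_mul a) (ae_of_all _ bd)
  have iD : Integrable (fun y => 2 * f y * f' y) volume := by
    simpa [← mul_assoc, ha.ne'] using iD'.const_mul a⁻¹
  -- `f ^ 2` and its derivative are both integrable, so `f ^ 2` vanishes at `±∞`.
  have t1 := tendsto_zero_of_hasDerivAt_of_integrableOn_Ioi (a := x) (fun y _ => hd2 y)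
    iD.integrableOn hf.integrableOn
  have t2 := tendsto_zero_of_hasDerivAt_of_integrableOn_Iic (a := x) (fun y _ => hd2 y)
    iD.integrableOn hf.integrableOn
  have e1 := integral_Ioi_of_hasDerivAt_of_tendsto' (a := x) (fun y _ => hd2 y)
    iD.integrableOn t1
  have e2 := integral_Iic_of_hasDerivAt_of_tendsto' (a := x) (fun y _ => hd2 y)
    iD.integrableOn t2
  -- Each half-line contributes `a * f x ^ 2`, whence the factor 2.
  have b1 : -(∫ y in Ioi x, a * (2 * f y * f' y)) ≤ ∫ y in Ioi x, (f' y ^ 2 + a ^ 2 * f y ^ 2) := by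
    rw [← integral_neg]
    exact integral_mono iD'.integrableOn.neg iR.integrableOn
      fun y => (neg_le_abs _).trans (bd y)
  have b2 : ∫ y in Iic x, a * (2 * f y * f' y) ≤ ∫ y in Iic x, (f' y ^ 2 + a ^ 2 * f y ^ 2) :=
    integral_mono iD'.integrableOn iR.integrableOn fun y => (le_abs_self _).trans (bd y)
  rw [integral_const_mul] at b1 b2
  rw [e1] at b1
  rw [e2] at b2
  have s := integral_add_compl (measurableSet_Iic (a := x)) iR
  rw [compl_Iic, integral_add hf' (hf.const_mul _), integral_const_mul] at s
  linarith

/-- The sharp embedding of `H¹(ℝ)` into `L^∞(ℝ)`. -/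
theorem HasWeakDeriv.ae_two_mul_sq_le {u g : ℝ → ℝ} {a : ℝ} (ha : 0 < a)
    (h : HasWeakDeriv u g) (hu : MemLp u 2 volume) (hg : MemLp g 2 volume) :
    ∀ᵐ x, 2 * a * u x ^ 2 ≤ (∫ y, g y ^ 2) + a ^ 2 * ∫ y, u y ^ 2 := by
  -- The ratio of the radii stays bounded (here 2), as almost everywhere convergence at Lebesgue
  -- points requires.
  let φ : ℕ → ContDiffBump (0 : ℝ) := fun n =>
    { rIn := 1 / ((n : ℝ) + 1)
      rOut := 2 * (1 / ((n : ℝ) + 1))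
      rIn_pos := by positivity
      rIn_lt_rOut := lt_two_mul_self (by positivity) }
  have hφ : Tendsto (fun n => (φ n).rOut) atTop (𝓝 0) := by
    simpa [φ] using (tendsto_one_div_add_atTop_nhds_zero_nat (𝕜 := ℝ)).const_mul 2
  have hlim := ContDiffBump.ae_convolution_tendsto_right_of_locallyIntegrable (μ := volume)
    (K := 2) hφ (Eventually.of_forall fun n => le_rfl) h.1
  filter_upwards [hlim] with x hx
  refine le_of_tendsto ((hx.pow 2).const_mul (2 * a)) (Eventually.of_forall fun n => ?_)
  have c0 : Continuous ((φ n).normed volume) := (φ n).continuous_normed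
  have cc : HasCompactSupport ((φ n).normed volume) := (φ n).hasCompactSupport_normed
  have n0 := (φ n).nonneg_normed (μ := volume)
  have n1 := (φ n).integral_normed (μ := volume)
  have key := two_mul_sq_le_of_hasDerivAt ha
    (fun x => h.hasDerivAt_convolution (φ n).contDiff_normed cc x)
    (cc.continuous_convolution_left (lsmul ℝ ℝ) c0 h.2.1).aestronglyMeasurable
    (integrable_sq_convolution c0 cc n0 n1 h.1 hu.integrable_sq)
    (integrable_sq_convolution c0 cc n0 n1 h.2.1 hg.integrable_sq) x
  have l1 := integral_sq_convolution_le c0 cc n0 n1 h.1 hu.integrable_sq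
  have l2 := integral_sq_convolution_le c0 cc n0 n1 h.2.1 hg.integrable_sq
  have := mul_le_mul_of_nonneg_left l1 (sq_nonneg a)
  linarith

/-! ### The lower bound -/

theorem normVSq_eq {V u g : ℝ → ℝ} (h : HasWeakDeriv u g) :
    normVSq V u = ∫ x, (g x ^ 2 + V x * u x ^ 2) := by
  refine integral_congr_ae ?_
  filter_upwards [h.weakDeriv_ae_eq] with x hx
  rw [hx, sq_abs, sq_abs]

theorem integrable_mul_sq {V u : ℝ → ℝ} (hV : MemLp V ⊤ volume) (hu : MemLp u 2 volume) :
    Integrable (fun x => V x * u x ^ 2) volume :=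
  hu.integrable_sq.mul_of_top_right hV

theorem supNorm_sq_le {u : ℝ → ℝ} {C : ℝ} (h : ∀ᵐ x, u x ^ 2 ≤ C) : supNorm u ^ 2 ≤ C := by
  have hC : 0 ≤ C := by
    obtain ⟨x, hx⟩ := h.exists
    exact (sq_nonneg _).trans hx
  have h1 : eLpNorm u ⊤ volume ≤ ENNReal.ofReal (√C) := by
    rw [eLpNorm_exponent_top]
    refine eLpNormEssSup_le_of_ae_bound ?_
    filter_upwards [h] with x hx
    exact Real.abs_le_sqrt hx
  calc supNorm u ^ 2 ≤ √C ^ 2 :=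
        pow_le_pow_left₀ ENNReal.toReal_nonneg (ENNReal.toReal_le_of_le_ofReal (by positivity) h1) 2
    _ = C := Real.sq_sqrt hC

/-- The bound `C` matters: `toReal` sends an infinite norm to 0, so finiteness is needed besides `u`
being nonzero. -/
theorem supNorm_pos {u : ℝ → ℝ} {C : ℝ} (hm : AEStronglyMeasurable u volume)
    (h : ∀ᵐ x, u x ^ 2 ≤ C) (h0 : ¬ u =ᵐ[volume] 0) : 0 < supNorm u := by
  refine ENNReal.toReal_pos (fun e => h0 ((eLpNorm_eq_zero_iff hm (by simp)).1 e)) ?_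
  refine (memLp_top_of_bound hm (√C) ?_).2.ne
  filter_upwards [h] with x hx
  exact Real.abs_le_sqrt hx

/-- Every Rayleigh quotient is at least `2 √v₀`. -/
theorem two_mul_sqrt_le_rayleigh {V u : ℝ → ℝ} {v₀ : ℝ} (hV : MemLp V ⊤ volume) (hv₀ : 0 < v₀)
    (hbd : ∀ᵐ x, v₀ ≤ V x) (hu : MemH1 u) (h0 : ¬ u =ᵐ[volume] 0) :
    2 * √v₀ ≤ rayleigh V u := by
  obtain ⟨hu2, g, hg2, hg⟩ := hu
  have ha : 0 < √v₀ := Real.sqrt_pos.2 hv₀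
  have hle : (∫ y, g y ^ 2) + √v₀ ^ 2 * ∫ y, u y ^ 2 ≤ normVSq V u := by
    rw [normVSq_eq hg, Real.sq_sqrt hv₀.le, ← integral_const_mul,
      ← integral_add hg2.integrable_sq (hu2.integrable_sq.const_mul _)]
    refine integral_mono_ae (hg2.integrable_sq.add (hu2.integrable_sq.const_mul _))
      (hg2.integrable_sq.add (integrable_mul_sq hV hu2)) ?_
    filter_upwards [hbd] with x hx
    exact add_le_add le_rfl (mul_le_mul_of_nonneg_right hx (sq_nonneg _))
  have hb : ∀ᵐ x, u x ^ 2 ≤ normVSq V u / (2 * √v₀) := by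
    filter_upwards [hg.ae_two_mul_sq_le ha hu2 hg2] with x hx
    rw [le_div_iff₀ (by positivity)]
    linarith
  have hp := supNorm_pos hu2.1 hb h0
  have hs := supNorm_sq_le hb
  rw [le_div_iff₀ (by positivity)] at hs
  rw [rayleigh, le_div_iff₀ (by positivity)]
  linarith

/-! ### The exponential test function -/

/-- The weak derivative of `x ↦ exp (-(a * |x|))`. -/
noncomputable def expAbsDeriv (a x : ℝ) : ℝ :=
  if x ≤ 0 then a * Real.exp (a * x) else -(a * Real.exp (-(a * x)))

theorem expAbsDeriv_sq (a x : ℝ) :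
    expAbsDeriv a x ^ 2 = a ^ 2 * Real.exp (-(a * |x|)) ^ 2 := by
  unfold expAbsDeriv
  split_ifs with h
  · rw [abs_of_nonpos h, mul_pow]
    ring_nf
  · rw [abs_of_pos (not_le.1 h), neg_sq, mul_pow]

theorem integral_exp_abs_sq {a : ℝ} (ha : 0 < a) :
    ∫ x : ℝ, Real.exp (-(a * |x|)) ^ 2 = 1 / a := by
  have e : ∀ x : ℝ, Real.exp (-(a * x)) ^ 2 = Real.exp (-(2 * a) * x) := fun x => by
    rw [← Real.exp_nat_mul]
    congr 1
    push_cast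
    ring
  rw [integral_comp_abs (f := fun x => Real.exp (-(a * x)) ^ 2)]
  simp_rw [e]
  rw [integral_exp_mul_Ioi (by linarith)]
  simp
  field_simp

theorem memLp_exp_abs {a : ℝ} (ha : 0 < a) :
    MemLp (fun x : ℝ => Real.exp (-(a * |x|))) 2 volume := by
  have hc : Continuous fun x : ℝ => Real.exp (-(a * |x|)) := by fun_prop
  rw [memLp_two_iff_integrable_sq hc.aestronglyMeasurable]
  -- A non-integrable function would have integral 0 by convention.
  refine Integrable.of_integral_ne_zero ?_
  rw [integral_exp_abs_sq ha]
  positivity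

theorem memLp_expAbsDeriv {a : ℝ} (ha : 0 < a) : MemLp (expAbsDeriv a) 2 volume := by
  have hm : Measurable (expAbsDeriv a) :=
    Measurable.ite measurableSet_Iic (by fun_prop) (by fun_prop)
  rw [memLp_two_iff_integrable_sq hm.aestronglyMeasurable]
  simp_rw [expAbsDeriv_sq]
  exact (memLp_exp_abs ha).integrable_sq.const_mul _

/-- Integration by parts on each side of the kink; by continuity the two boundary terms at 0 cancel.
-/
theorem hasWeakDeriv_exp_abs {a : ℝ} (ha : 0 < a) :
    HasWeakDeriv (fun x : ℝ => Real.exp (-(a * |x|))) (expAbsDeriv a) := by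
  have l1 := (memLp_exp_abs ha).locallyIntegrable one_le_two
  have l2 := (memLp_expAbsDeriv ha).locallyIntegrable one_le_two
  refine ⟨l1, l2, fun φ hφ hc => ?_⟩
  have hφd : ∀ x, HasDerivAt φ (deriv φ x) x := fun x =>
    (hφ.differentiable (by simp) x).hasDerivAt
  have hφ' : Continuous (deriv φ) := hφ.continuous_deriv (by exact_mod_cast le_top)
  have i1 : Integrable (fun x : ℝ => Real.exp (-(a * |x|)) * deriv φ x) volume := by
    simpa only [smul_eq_mul, mul_comm (deriv φ _)] using
      l1.integrable_smul_left_of_hasCompactSupport hφ' hc.deriv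
  have i2 : Integrable (fun x : ℝ => expAbsDeriv a x * φ x) volume := by
    simpa only [smul_eq_mul, mul_comm (φ _)] using
      l2.integrable_smul_left_of_hasCompactSupport hφ.continuous hc
  have i := i1.add i2
  have hF : Continuous fun x : ℝ => Real.exp (-(a * |x|)) * φ x :=
    (by fun_prop : Continuous fun x : ℝ => Real.exp (-(a * |x|))).mul hφ.continuous
  have hFc : HasCompactSupport fun x : ℝ => Real.exp (-(a * |x|)) * φ x := hc.mul_left
  have e1 := integral_Ioi_of_hasDerivAt_of_tendsto (a := 0) hF.continuousWithinAt (m := 0)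
    (f' := fun x => Real.exp (-(a * |x|)) * deriv φ x + expAbsDeriv a x * φ x)
    (fun x (hx : 0 < x) => by
      have h1 : HasDerivAt (fun x => Real.exp (-(a * x))) (Real.exp (-(a * x)) * -(a * 1)) x :=
        ((hasDerivAt_id x).const_mul a).neg.exp
      refine ((h1.mul (hφd x)).congr_of_eventuallyEq ?_).congr_deriv ?_
      · filter_upwards [lt_mem_nhds hx] with y hy
        simp [abs_of_pos hy]
      · simp only [expAbsDeriv, not_le.2 hx, abs_of_pos hx, if_false]
        ring)
    i.integrableOn (hFc.is_zero_at_infty.mono_left atTop_le_cocompact)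
  have e2 := integral_Iic_of_hasDerivAt_of_tendsto (a := 0) hF.continuousWithinAt (m := 0)
    (f' := fun x => Real.exp (-(a * |x|)) * deriv φ x + expAbsDeriv a x * φ x)
    (fun x (hx : x < 0) => by
      have h1 : HasDerivAt (fun x => Real.exp (a * x)) (Real.exp (a * x) * (a * 1)) x :=
        ((hasDerivAt_id x).const_mul a).exp
      refine ((h1.mul (hφd x)).congr_of_eventuallyEq ?_).congr_deriv ?_
      · filter_upwards [gt_mem_nhds hx] with y hy
        simp [abs_of_neg hy]
      · simp only [expAbsDeriv, hx.le, abs_of_neg hx, if_true, mul_neg, neg_neg]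
        ring)
    i.integrableOn (hFc.is_zero_at_infty.mono_left atBot_le_cocompact)
  have s := integral_add_compl (measurableSet_Iic (a := (0 : ℝ))) i
  rw [compl_Iic] at s
  simp only [Pi.add_apply] at s
  rw [e1, e2, integral_add i1 i2] at s
  linarith

theorem memH1_exp_abs {a : ℝ} (ha : 0 < a) : MemH1 fun x : ℝ => Real.exp (-(a * |x|)) :=
  ⟨memLp_exp_abs ha, _, memLp_expAbsDeriv ha, hasWeakDeriv_exp_abs ha⟩

theorem exp_abs_not_ae_zero (a : ℝ) :
    ¬ (fun x : ℝ => Real.exp (-(a * |x|))) =ᵐ[volume] 0 := fun h => by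
  obtain ⟨x, hx⟩ := h.exists
  exact (Real.exp_pos _).ne' hx

/-- The almost everywhere bound holds on a dense set, which is closed by continuity. -/
theorem abs_le_supNorm {u : ℝ → ℝ} (hc : Continuous u) (hu : eLpNorm u ⊤ volume ≠ ⊤) (x : ℝ) :
    |u x| ≤ supNorm u := by
  have h : ∀ᵐ y, |u y| ≤ supNorm u := by
    rw [eLpNorm_exponent_top] at hu
    filter_upwards [ae_le_eLpNormEssSup (f := u) (μ := volume)] with y hy
    have := ENNReal.toReal_mono hu hy
    simpa [supNorm] using this
  have hd := Measure.dense_of_ae h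
  have hcl : IsClosed {y | |u y| ≤ supNorm u} := isClosed_le hc.abs continuous_const
  have : x ∈ closure {y | |u y| ≤ supNorm u} := hd x
  rwa [hcl.closure_eq] at this

theorem one_le_supNorm_exp_abs {a : ℝ} (ha : 0 < a) :
    1 ≤ supNorm fun x : ℝ => Real.exp (-(a * |x|)) := by
  have hc : Continuous fun x : ℝ => Real.exp (-(a * |x|)) := by fun_prop
  have hb : MemLp (fun x : ℝ => Real.exp (-(a * |x|))) ⊤ volume := by
    refine memLp_top_of_bound hc.aestronglyMeasurable 1 (ae_of_all _ fun x => ?_)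
    rw [Real.norm_of_nonneg (Real.exp_pos _).le, Real.exp_le_one_iff]
    have := mul_nonneg ha.le (abs_nonneg x)
    linarith
  simpa using abs_le_supNorm hc hb.2.ne 0

/-- The Rayleigh quotient of `x ↦ exp (-(√v₁ * |x|))` is at most `2 √v₁`. -/
theorem rayleigh_exp_abs_le {V : ℝ → ℝ} {v₁ : ℝ} (hV : MemLp V ⊤ volume) (hv₁ : 0 < v₁)
    (hbd : ∀ᵐ x, V x ≤ v₁) :
    rayleigh V (fun x : ℝ => Real.exp (-(√v₁ * |x|))) ≤ 2 * √v₁ := by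
  have ha : 0 < √v₁ := Real.sqrt_pos.2 hv₁
  have hs := one_le_supNorm_exp_abs ha
  have hu := memLp_exp_abs ha
  have hn : normVSq V (fun x : ℝ => Real.exp (-(√v₁ * |x|))) ≤ 2 * √v₁ := by
    rw [normVSq_eq (hasWeakDeriv_exp_abs ha)]
    calc ∫ x, (expAbsDeriv √v₁ x ^ 2 + V x * Real.exp (-(√v₁ * |x|)) ^ 2)
        ≤ ∫ x : ℝ, 2 * v₁ * Real.exp (-(√v₁ * |x|)) ^ 2 := by
          refine integral_mono_ae
            ((memLp_expAbsDeriv ha).integrable_sq.add (integrable_mul_sq hV hu))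
            (hu.integrable_sq.const_mul _) ?_
          filter_upwards [hbd] with x hx
          have := mul_le_mul_of_nonneg_right hx (sq_nonneg (Real.exp (-(√v₁ * |x|))))
          simp only [expAbsDeriv_sq, Real.sq_sqrt hv₁.le]
          linarith
      _ = 2 * √v₁ := by
          rw [integral_const_mul, integral_exp_abs_sq ha]
          field_simp
          rw [Real.sq_sqrt hv₁.le]
  refine (div_le_iff₀ (by positivity)).2 (hn.trans ?_)
  exact le_mul_of_one_le_right (by positivity) (one_le_pow₀ hs)

end SobolevOneDim

theorem mainTheorem7 (V : ℝ → ℝ) (v₀ v₁ : ℝ) (hV : MemLp V ⊤ volume) (hv₀ : 0 < v₀)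
    (hbd : ∀ᵐ x ∂(volume : Measure ℝ), v₀ ≤ V x ∧ V x ≤ v₁) :
    2 * (v₀ / √v₁) ≤ SobolevOneDim.m V ∧ SobolevOneDim.m V ≤ 2 * (v₁ / √v₀) := by
  open SobolevOneDim in
  have h01 : v₀ ≤ v₁ := by
    obtain ⟨x, hx⟩ := hbd.exists
    exact hx.1.trans hx.2
  have hv₁ : 0 < v₁ := hv₀.trans_le h01
  have hs₀ : 0 < √v₀ := Real.sqrt_pos.2 hv₀
  have hs₁ : 0 < √v₁ := Real.sqrt_pos.2 hv₁
  have hs : √v₀ ≤ √v₁ := Real.sqrt_le_sqrt h01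
  have hmem : rayleigh V (fun x : ℝ => Real.exp (-(√v₁ * |x|))) ∈
      {r : ℝ | ∃ u : ℝ → ℝ, MemH1 u ∧ ¬ u =ᵐ[volume] 0 ∧ r = rayleigh V u} :=
    ⟨_, memH1_exp_abs hs₁, exp_abs_not_ae_zero _, rfl⟩
  have hlb : 2 * √v₀ ∈ lowerBounds
      {r : ℝ | ∃ u : ℝ → ℝ, MemH1 u ∧ ¬ u =ᵐ[volume] 0 ∧ r = rayleigh V u} := by
    rintro r ⟨u, hu, h0, rfl⟩
    exact two_mul_sqrt_le_rayleigh hV hv₀ (hbd.mono fun _ h => h.1) hu h0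
  constructor
  -- What remains is `v₀ / √v₁ ≤ √v₀`.
  · refine le_trans ?_ (le_csInf ⟨_, hmem⟩ hlb)
    gcongr
    rw [div_le_iff₀ hs₁]
    calc v₀ = √v₀ * √v₀ := (Real.mul_self_sqrt hv₀.le).symm
      _ ≤ √v₀ * √v₁ := by gcongr
  · refine (csInf_le ⟨_, hlb⟩ hmem).trans
      ((rayleigh_exp_abs_le hV hv₁ (hbd.mono fun _ h => h.2)).trans ?_)
    gcongr
    rw [le_div_iff₀ hs₀]
    calc √v₁ * √v₀ ≤ √v₁ * √v₁ := by gcongr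
      _ = v₁ := Real.mul_self_sqrt hv₁.le
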